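/- Let $F$ be a field of characteristic $2$, let $V$ be a finite dimensional vector space over $F$, and let $f:V\times V\to F$ be an arbitrary bilinear form (not assumed to be symmetric, alternating or non-degenerate). Let $$L(f)=\{x\in\mathfrak{gl}(V) : f(xv,w)=-f(v,xw)\ \text{for all } v,w\in V\}$$ be the Lie subalgebra of $\mathfrak{gl}(V)$ of all endomorphisms that are skew-adjoint with respect to $f$. If $n>2$ is an integer, then $L(f)$ is not isomorphic, as a Lie algebra over $F$, to $\mathfrak{sl}(n)$, the Lie algebra of all $n\times n$ matrices of trace zero over $F$. -/

import Mathlib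

attribute [local instance 100] LieRing.ofAssociativeRing

open LieAlgebra.SpecialLinear

/-! ### Brackets of matrix units and diagonal elements in `sl`. -/

section SpecialLinear

variable {F ι : Type*} [Field F] [Fintype ι] [DecidableEq ι]

/-! In characteristic 2 skew-adjoint means self-adjoint, so L(f) contains 1 and the product of any
two of its commuting elements. An isomorphism would thus give an injective Lie map X from sl(n) to
End V whose image has both properties; `not_injective_of_mul_closed` excludes this.

A preimage of 1 is a nonzero scalar of trace zero, so n is even and n ≥ 4. Write H_ab = E_aa - E_bb.
As ad is a derivation, a preimage of a product is pinned down by what commutes with both factors.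
This gives X(H_ab)X(E_cd) = 0 for distinct indices, and then X(H_ab)X(H_bc) = X(t) with t scalar.
Bracketing with E_ab yields X(H_ab)X(E_ab) = 0, which is impossible. -/

theorem LieAlgebra.SpecialLinear.commute_of_lie_single_eq_zero {i j : ι} {h : i ≠ j}
    {z : sl ι F} (hz : ⁅z, single i j h (1 : F)⁆ = 0) : Commute (Matrix.single i j 1) z.val := by
  have := congrArg Subtype.val hz
  rw [sl_bracket, val_single] at this
  exact (sub_eq_zero.mp this).symm

theorem LieAlgebra.SpecialLinear.lie_single_single_eq_zero {i j k l : ι} (h : i ≠ j) (h' : k ≠ l)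
    (hjk : j ≠ k) (hil : i ≠ l) : ⁅single i j h (1 : F), single k l h' (1 : F)⁆ = 0 := by
  ext : 1
  rw [sl_bracket, val_single, val_single, Matrix.single_mul_single_of_ne _ _ _ _ hjk,
    Matrix.single_mul_single_of_ne _ _ _ _ hil.symm, sub_zero]
  rfl

theorem LieAlgebra.SpecialLinear.lie_single_single_swap {i j : ι} (h : i ≠ j) (h' : j ≠ i) :
    ⁅single i j h (1 : F), single j i h' (1 : F)⁆ = singleSubSingle i j 1 := by
  ext : 1
  rw [sl_bracket, val_single, val_single, Matrix.single_mul_single_same,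
    Matrix.single_mul_single_same, val_singleSubSingle, one_mul]

theorem LieAlgebra.SpecialLinear.val_singleSubSingle_eq_diagonal (a b : ι) :
    (singleSubSingle a b (1 : F)).val =
      Matrix.diagonal fun k => (if k = a then 1 else 0) - (if k = b then 1 else 0) := by
  ext k l
  rw [val_singleSubSingle]
  simp only [Matrix.sub_apply, Matrix.single_apply, Matrix.diagonal_apply]
  grind

theorem LieAlgebra.SpecialLinear.lie_singleSubSingle_apply (a b : ι) (z : sl ι F) (i j : ι) :
    (⁅singleSubSingle a b (1 : F), z⁆ : sl ι F).val i j =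
      (((if i = a then 1 else 0) - (if i = b then 1 else 0)) -
        ((if j = a then 1 else 0) - (if j = b then 1 else 0))) * z.val i j := by
  rw [sl_bracket, val_singleSubSingle_eq_diagonal, Matrix.sub_apply, Matrix.diagonal_mul,
    Matrix.mul_diagonal]
  ring

theorem LieAlgebra.SpecialLinear.lie_singleSubSingle_single (a b : ι) {i j : ι} (h : i ≠ j) :
    ⁅singleSubSingle a b (1 : F), single i j h (1 : F)⁆ =
      (((if i = a then 1 else 0) - (if i = b then 1 else 0)) -
        ((if j = a then 1 else 0) - (if j = b then 1 else 0)) : F) • single i j h (1 : F) := by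
  ext k l
  rw [lie_singleSubSingle_apply]
  change _ = _ * (single i j h (1 : F)).val k l
  rw [val_single, Matrix.single_apply]
  split_ifs <;> simp_all

theorem LieAlgebra.SpecialLinear.lie_singleSubSingle_singleSubSingle (a b c d : ι) :
    ⁅singleSubSingle a b (1 : F), singleSubSingle c d (1 : F)⁆ = 0 := by
  ext : 1
  rw [sl_bracket, val_singleSubSingle_eq_diagonal, val_singleSubSingle_eq_diagonal,
    Matrix.diagonal_mul_diagonal, Matrix.diagonal_mul_diagonal]
  exact sub_eq_zero.2 (congrArg Matrix.diagonal (funext fun _ => mul_comm _ _))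

theorem LieAlgebra.SpecialLinear.single_one_ne_zero {i j : ι} (h : i ≠ j) :
    single i j h (1 : F) ≠ 0 := by
  intro h0
  have := congrArg (fun z : sl ι F => z.val i j) h0
  simp at this

theorem LieAlgebra.SpecialLinear.trace_val (z : sl ι F) : z.val.trace = 0 :=
  LinearMap.mem_ker.1 z.2

end SpecialLinear

/-! ### Lie maps whose image is closed under commuting products. -/

section CommutingProducts

variable {F ι A : Type*} [Field F] [Fintype ι] [DecidableEq ι] [Ring A] [Algebra F A]

/-- The Leibniz rule for ad, transported to preimages of products. -/
theorem LieHom.map_lie_of_map_eq_mul {L : Type*} [LieRing L] [LieAlgebra F L] (X : L →ₗ⁅F⁆ A)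
    {x y z : L} (h : X z = X x * X y) (w : L) : X ⁅w, z⁆ = X ⁅w, x⁆ * X y + X x * X ⁅w, y⁆ := by
  simp only [LieHom.map_lie, LieRing.of_associative_ring_bracket, h]
  noncomm_ring

variable [CharP F 2] {X : sl ι F →ₗ⁅F⁆ A}

/-- The preimage z commutes with everything that commutes with both H_ab and E_cd, and it has the
same H_ac-weight as E_cd; only its (c, d) entry survives. -/
theorem LieAlgebra.SpecialLinear.exists_map_singleSubSingle_mul_map_single
    (hX : Function.Injective X)
    (hmul : ∀ x y, ⁅x, y⁆ = 0 → ∃ z, X z = X x * X y)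
    {a b c d : ι} (hab : a ≠ b) (hac : a ≠ c) (had : a ≠ d) (hbc : b ≠ c) (hbd : b ≠ d)
    (hcd : c ≠ d) :
    ∃ γ : F, X (singleSubSingle a b 1) * X (single c d hcd 1) = γ • X (single c d hcd 1) := by
  obtain ⟨z, hz⟩ := hmul (singleSubSingle a b 1) (single c d hcd 1) (by
    rw [lie_singleSubSingle_single]
    simp [hac.symm, had.symm, hbc.symm, hbd.symm])
  have comm (w : sl ι F) (h1 : ⁅w, singleSubSingle a b (1 : F)⁆ = 0)
      (h3 : ⁅w, single c d hcd (1 : F)⁆ = 0) : ⁅z, w⁆ = 0 := by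
    have := X.map_lie_of_map_eq_mul hz w
    rw [h1, h3, map_zero, zero_mul, mul_zero, add_zero] at this
    rw [← lie_skew, neg_eq_zero]
    exact hX (this.trans (map_zero X).symm)
  -- Since 1 = -1, H_ab acts on E_ij by 0 as soon as i and j are both inside or both outside {a, b}.
  have commE {i j : ι} (hij : i ≠ j) (hi : (i = a ∨ i = b) ↔ (j = a ∨ j = b)) (hjc : j ≠ c)
      (hid : i ≠ d) : Commute (Matrix.single i j 1) z.val := by
    refine commute_of_lie_single_eq_zero (h := hij) (comm _ ?_
      (lie_single_single_eq_zero _ _ hjc hid))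
    rw [← lie_skew, lie_singleSubSingle_single, neg_eq_zero]
    convert zero_smul F _
    by_cases h : j = a ∨ j = b
    · rcases hi.2 h with rfl | rfl <;> rcases h with rfl | rfl <;>
        simp [hij, hij.symm, CharTwo.sub_eq_add]
    · obtain ⟨ha, hb⟩ := not_or.1 h
      obtain ⟨ha', hb'⟩ := not_or.1 (mt hi.1 h)
      simp [ha, hb, ha', hb']
  -- Weight 1 for a diagonal element forces the diagonal of z to vanish.
  have hwt : ⁅singleSubSingle a c (1 : F), z⁆ = z := by
    apply hX
    rw [X.map_lie_of_map_eq_mul hz, lie_singleSubSingle_singleSubSingle,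
      lie_singleSubSingle_single, hz]
    have : (((if c = a then 1 else 0) - (if c = c then 1 else 0)) -
        ((if d = a then 1 else 0) - (if d = c then 1 else 0)) : F) = 1 := by
      simp [hac.symm, had.symm, hcd.symm, CharTwo.neg_eq]
    rw [this, one_smul, map_zero, zero_mul, zero_add]
  refine ⟨z.val c d, ?_⟩
  rw [← hz, ← map_smul]
  congr 1
  ext i j
  change _ = z.val c d * (single c d hcd (1 : F)).val i j
  rw [val_single, Matrix.single_apply]
  split_ifs with hij
  · rw [mul_one, hij.1, hij.2]
  rw [mul_zero]
  by_cases hd : i = j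
  · subst hd
    rw [← hwt, lie_singleSubSingle_apply, sub_self, zero_mul]
  by_cases hjd : j = d
  · have hic : i ≠ c := fun h => hij ⟨h.symm, hjd.symm⟩
    by_cases hia : i = a
    · subst hia
      exact Matrix.row_eq_zero_of_commute_single
        (commE hab.symm (iff_of_true (.inr rfl) (.inl rfl)) hac hbd) (Ne.symm hd)
    by_cases hib : i = b
    · subst hib
      exact Matrix.row_eq_zero_of_commute_single
        (commE hab (iff_of_true (.inl rfl) (.inr rfl)) hbc had) (Ne.symm hd)
    exact Matrix.row_eq_zero_of_commute_single
      (commE hic.symm (iff_of_false (by simp [hac.symm, hbc.symm]) (by simp [hia, hib])) hic hcd)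
      (Ne.symm hd)
  · by_cases hja : j = a
    · subst hja
      exact Matrix.col_eq_zero_of_commute_single
        (commE hab (iff_of_true (.inl rfl) (.inr rfl)) hbc had) hd
    by_cases hjb : j = b
    · subst hjb
      exact Matrix.col_eq_zero_of_commute_single
        (commE hab.symm (iff_of_true (.inr rfl) (.inl rfl)) hac hbd) hd
    exact Matrix.col_eq_zero_of_commute_single
      (commE hjd (iff_of_false (by simp [hja, hjb]) (by simp [had.symm, hbd.symm])) hcd.symm hjd)
      hd

/-- Bracketing with E_dc turns the scalar γ into X(H_ab)X(H_cd) = γ X(H_cd). Exchanging the pairs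
makes the same product δ X(H_ab), and independence of H_ab and H_cd gives γ = 0. -/
theorem LieAlgebra.SpecialLinear.map_singleSubSingle_mul_map_single_eq_zero
    (hX : Function.Injective X)
    (hmul : ∀ x y, ⁅x, y⁆ = 0 → ∃ z, X z = X x * X y)
    {a b c d : ι} (hab : a ≠ b) (hac : a ≠ c) (had : a ≠ d) (hbc : b ≠ c) (hbd : b ≠ d)
    (hcd : c ≠ d) : X (singleSubSingle a b 1) * X (single c d hcd 1) = 0 := by
  have key {a b c d : ι} (hac : a ≠ c) (had : a ≠ d) (hbc : b ≠ c) (hbd : b ≠ d)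
      (hcd : c ≠ d) (γ : F)
      (h : X (singleSubSingle a b 1) * X (single c d hcd 1) = γ • X (single c d hcd 1)) :
      X (singleSubSingle a b 1) * X (singleSubSingle d c 1) = γ • X (singleSubSingle d c 1) := by
    have h' : X (γ • single c d hcd 1) = X (singleSubSingle a b 1) * X (single c d hcd 1) := by
      rw [h, map_smul]
    have := X.map_lie_of_map_eq_mul h' (single d c hcd.symm 1)
    rw [lie_smul, lie_single_single_swap, ← lie_skew, lie_singleSubSingle_single] at this
    simpa [hac.symm, had.symm, hbc.symm, hbd.symm] using this.symm
  have swap (a b : ι) : singleSubSingle a b (1 : F) = -singleSubSingle b a 1 := by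
    ext : 1
    change _ = -(singleSubSingle b a (1 : F)).val
    simp
  obtain ⟨γ, h⟩ := exists_map_singleSubSingle_mul_map_single hX hmul hab hac had hbc hbd hcd
  obtain ⟨δ, h'⟩ := exists_map_singleSubSingle_mul_map_single hX hmul hcd hac.symm hbc.symm
    had.symm hbd.symm hab
  have e1 := key hac had hbc hbd hcd γ h
  have e2 := key hac.symm hbc.symm had.symm hbd.symm hab δ h'
  have hc : X (singleSubSingle a b 1) * X (singleSubSingle c d 1) =
      X (singleSubSingle c d 1) * X (singleSubSingle a b 1) := by
    rw [← sub_eq_zero, ← LieRing.of_associative_ring_bracket, ← LieHom.map_lie,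
      lie_singleSubSingle_singleSubSingle, map_zero]
  rw [swap d c, map_neg, mul_neg, smul_neg, neg_inj, hc] at e1
  rw [swap b a, map_neg, mul_neg, smul_neg, neg_inj, e1, ← map_smul X, ← map_smul X] at e2
  have hγ := congrArg (fun z : sl ι F => z.val c c) (hX e2)
  change γ * (singleSubSingle c d (1 : F)).val c c = δ * (singleSubSingle a b (1 : F)).val c c
    at hγ
  rw [val_singleSubSingle_eq_diagonal, val_singleSubSingle_eq_diagonal] at hγ
  have hγ0 : γ = 0 := by simpa [hcd, hac.symm, hbc.symm] using hγ
  rw [h, hγ0, zero_smul]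

/-- Were it zero, bracketing with E_ba would give H² = 0 for H = X(H_ab). With Y = X(E_ac) and [H,
Y] = Y this yields Y = -2HYH = 0. -/
theorem LieAlgebra.SpecialLinear.map_singleSubSingle_mul_map_single_ne_zero
    (hX : Function.Injective X) {a b c : ι} (hab : a ≠ b) (hac : a ≠ c) (hbc : b ≠ c) :
    X (singleSubSingle a b 1) * X (single a b hab 1) ≠ 0 := by
  have h2 : (1 + 1 : F) = 0 := CharTwo.add_self_eq_zero 1
  intro h0
  have h1 : X 0 = X (singleSubSingle a b 1) * X (single a b hab 1) := by rw [h0, map_zero]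
  have h := X.map_lie_of_map_eq_mul h1 (single b a hab.symm 1)
  have hsw : singleSubSingle b a (1 : F) = singleSubSingle a b 1 := by
    ext k l
    rw [val_singleSubSingle_eq_diagonal, val_singleSubSingle_eq_diagonal]
    simp only [Matrix.diagonal_apply]
    grind
  have hz : (((if b = a then 1 else 0) - (if b = b then 1 else 0)) -
        ((if a = a then 1 else 0) - (if a = b then 1 else 0)) : F) = 0 := by
    simp only [hab, hab.symm, if_true, if_false]
    grind
  rw [lie_zero, map_zero, ← lie_skew, lie_singleSubSingle_single, hz, zero_smul, neg_zero,
    map_zero, zero_mul, zero_add, lie_single_single_swap, hsw] at h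
  have hw : ⁅singleSubSingle a b (1 : F), single a c hac (1 : F)⁆ = single a c hac 1 := by
    rw [lie_singleSubSingle_single]
    simp [hab, hac.symm, hbc.symm]
  have e := congrArg X hw
  rw [LieHom.map_lie, LieRing.of_associative_ring_bracket] at e
  set H := X (singleSubSingle a b 1)
  set Y := X (single a c hac 1) with hY
  have e1 : H * Y = -(H * Y * H) := by
    nth_rw 1 [← e]
    rw [mul_sub, ← mul_assoc, ← h, zero_mul, zero_sub, mul_assoc]
  have e2 : Y * H = H * Y * H := by
    nth_rw 1 [← e]
    rw [sub_mul, mul_assoc Y, ← h, mul_zero, sub_zero]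
  have hY0 : Y = 0 := by
    rw [← e, e1, e2, ← neg_add', ← one_smul F (H * Y * H), ← add_smul, h2, zero_smul, neg_zero]
  exact single_one_ne_zero hac (hX ((hY ▸ hY0).trans (map_zero X).symm))

theorem LieAlgebra.SpecialLinear.not_injective_of_mul_closed
    (hι : 2 < Fintype.card ι) (hone : ∃ z, X z = 1)
    (hmul : ∀ x y, ⁅x, y⁆ = 0 → ∃ z, X z = X x * X y) : ¬ Function.Injective X := by
  intro hX
  have hmap_comm {x y : sl ι F} (h : ⁅x, y⁆ = 0) : X x * X y = X y * X x := by
    rw [← sub_eq_zero, ← LieRing.of_associative_ring_bracket, ← LieHom.map_lie, h, map_zero]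
  -- A preimage of 1 is central, hence a nonzero scalar matrix of trace zero.
  have hcard : (Fintype.card ι : F) = 0 := by
    obtain ⟨z, hz⟩ := hone
    have hcen (w : sl ι F) : ⁅z, w⁆ = 0 := by
      apply hX
      rw [LieHom.map_lie, LieRing.of_associative_ring_bracket, hz, one_mul, mul_one, sub_self,
        map_zero]
    obtain ⟨r, hr⟩ := Matrix.mem_range_scalar_iff_commute_single.2 fun i j hij =>
      commute_of_lie_single_eq_zero (h := hij) (hcen _)
    have htr := trace_val z
    rw [← hr, Matrix.scalar_apply, Matrix.trace_diagonal, Finset.sum_const, Finset.card_univ,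
      nsmul_eq_mul] at htr
    refine (mul_eq_zero.1 htr).resolve_right fun hr0 => ?_
    have hz0 : z = 0 := by
      ext : 1
      rw [← hr, hr0, map_zero]
      rfl
    have h10 : (1 : A) = 0 := by rw [← hz, hz0, map_zero]
    obtain ⟨i, j, hij⟩ := Fintype.exists_pair_of_one_lt_card (one_lt_two.trans hι)
    refine single_one_ne_zero (F := F) hij (hX ?_)
    rw [← one_mul (X _), h10, zero_mul, map_zero]
  have h4 : 4 ≤ Fintype.card ι := by
    rw [CharP.cast_eq_zero_iff F 2] at hcard
    omega
  obtain ⟨v⟩ := Function.Embedding.nonempty_of_card_le (α := Fin 4) (β := ι) (by simpa using h4)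
  obtain ⟨a, b, c, d, hab, hac, had, hbc, hbd, hcd⟩ : ∃ a b c d : ι,
      a ≠ b ∧ a ≠ c ∧ a ≠ d ∧ b ≠ c ∧ b ≠ d ∧ c ≠ d :=
    ⟨v 0, v 1, v 2, v 3, by simp, by simp, by simp, by simp, by simp, by simp⟩
  obtain ⟨t, ht⟩ := hmul _ _ (lie_singleSubSingle_singleSubSingle (F := F) a b b c)
  have hmul0 {p q i j : ι} (hpq : p ≠ q) (hpi : p ≠ i) (hpj : p ≠ j) (hqi : q ≠ i) (hqj : q ≠ j)
      (hij : i ≠ j) : X (singleSubSingle p q 1) * X (single i j hij 1) = 0 :=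
    map_singleSubSingle_mul_map_single_eq_zero hX hmul hpq hpi hpj hqi hqj hij
  have hlie0 {p q i j : ι} (hpi : p ≠ i) (hpj : p ≠ j) (hqi : q ≠ i) (hqj : q ≠ j)
      (hij : i ≠ j) : ⁅singleSubSingle p q (1 : F), single i j hij (1 : F)⁆ = 0 := by
    rw [lie_singleSubSingle_single]
    simp [hpi.symm, hpj.symm, hqi.symm, hqj.symm]
  -- If E_ij avoids the indices of one factor, that factor commutes with it and annihilates it,
  -- which kills both Leibniz terms.
  have hcomm {i j : ι} (hij : i ≠ j)
      (h : (a ≠ i ∧ a ≠ j ∧ b ≠ i ∧ b ≠ j) ∨ (b ≠ i ∧ b ≠ j ∧ c ≠ i ∧ c ≠ j)) :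
      Commute (Matrix.single i j 1) t.val := by
    refine commute_of_lie_single_eq_zero (h := hij) ?_
    rw [← lie_skew, neg_eq_zero]
    apply hX
    rw [X.map_lie_of_map_eq_mul ht, map_zero]
    rcases h with ⟨h1, h2, h3, h4⟩ | ⟨h1, h2, h3, h4⟩
    · rw [← lie_skew, hlie0 h1 h2 h3 h4, neg_zero, map_zero, zero_mul, zero_add, ← lie_skew,
        lie_singleSubSingle_single, map_neg, map_smul, mul_neg, mul_smul_comm,
        hmul0 hab h1 h2 h3 h4, smul_zero, neg_zero]
    · rw [← lie_skew _ (singleSubSingle b c 1), hlie0 h1 h2 h3 h4, neg_zero, map_zero, mul_zero,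
        add_zero, ← lie_skew, lie_singleSubSingle_single, map_neg, map_smul, neg_mul,
        smul_mul_assoc, ← hmap_comm (hlie0 h1 h2 h3 h4 hij), hmul0 hbc h1 h2 h3 h4, smul_zero,
        neg_zero]
  have hrow {i j : ι} (hij : i ≠ j) (hi : i ≠ b) : t.val i j = 0 := by
    by_cases hia : i = a
    · subst hia
      exact Matrix.row_eq_zero_of_commute_single
        (hcomm had.symm (.inr ⟨hbd, hab.symm, hcd, hac.symm⟩)) hij.symm
    by_cases hic : i = c
    · subst hic
      exact Matrix.row_eq_zero_of_commute_single
        (hcomm hcd.symm (.inl ⟨had, hac, hbd, hbc⟩)) hij.symm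
    exact Matrix.row_eq_zero_of_commute_single
      (hcomm (Ne.symm hia) (.inr ⟨hab.symm, hi.symm, hac.symm, Ne.symm hic⟩)) hij.symm
  have hcol {i j : ι} (hij : i ≠ j) (hj : j ≠ b) : t.val i j = 0 := by
    by_cases hja : j = a
    · subst hja
      exact Matrix.col_eq_zero_of_commute_single
        (hcomm had (.inr ⟨hab.symm, hbd, hac.symm, hcd⟩)) hij
    by_cases hjc : j = c
    · subst hjc
      exact Matrix.col_eq_zero_of_commute_single
        (hcomm hcd (.inl ⟨hac, had, hbc, hbd⟩)) hij
    exact Matrix.col_eq_zero_of_commute_single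
      (hcomm hja (.inr ⟨hj.symm, hab.symm, Ne.symm hjc, hac.symm⟩)) hij
  have hdiag {i : ι} (hi : i ≠ b) : t.val i i = t.val d d := by
    have had' := Matrix.diag_eq_of_commute_single
      (hcomm had (.inr ⟨hab.symm, hbd, hac.symm, hcd⟩))
    by_cases hia : i = a
    · rw [hia, had']
    by_cases hic : i = c
    · rw [hic]
      exact Matrix.diag_eq_of_commute_single (hcomm hcd (.inl ⟨hac, had, hbc, hbd⟩))
    rw [← had']
    exact Matrix.diag_eq_of_commute_single
      (hcomm hia (.inr ⟨hi.symm, hab.symm, Ne.symm hic, hac.symm⟩))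
  -- The one diagonal entry not reached by `hcomm` is fixed by the trace, because n = 0 in F.
  have hb : t.val b b = t.val d d := by
    have hsum : ∑ i, (t.val i i - t.val d d) = 0 := by
      rw [Finset.sum_sub_distrib, Finset.sum_const, Finset.card_univ, nsmul_eq_mul, hcard,
        zero_mul, sub_zero]
      exact trace_val t
    rw [Finset.sum_eq_single b (fun i _ hi => sub_eq_zero.2 (hdiag hi)) (by simp)] at hsum
    exact sub_eq_zero.1 hsum
  have hscalar : t.val = Matrix.scalar ι (t.val d d) := by
    ext i j
    rw [Matrix.scalar_apply, Matrix.diagonal_apply]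
    split_ifs with hij
    · subst hij
      by_cases hi : i = b
      · rw [hi, hb]
      · exact hdiag hi
    · by_cases hi : i = b
      · exact hcol hij fun hj => hij (hi.trans hj.symm)
      · exact hrow hij hi
  refine map_singleSubSingle_mul_map_single_ne_zero hX hab hac hbc ?_
  -- E_ab commutes with t and H_ab but has weight 1 for H_bc, so the Leibniz rule leaves
  -- X(H_ab)X(E_ab) = 0.
  have hlie : ⁅single a b hab (1 : F), t⁆ = 0 := by
    ext : 1
    rw [sl_bracket, hscalar, (Matrix.scalar_commute _ (Commute.all _) _).eq, sub_self]
    rfl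
  have hab0 : ⁅single a b hab (1 : F), singleSubSingle a b (1 : F)⁆ = 0 := by
    rw [← lie_skew, lie_singleSubSingle_single]
    simp [hab, hab.symm, sub_eq_add_neg, CharTwo.neg_eq]
  have hbc1 : ⁅single a b hab (1 : F), singleSubSingle b c (1 : F)⁆ = single a b hab 1 := by
    rw [← lie_skew, lie_singleSubSingle_single]
    simp [hab, hac, hbc]
  have := X.map_lie_of_map_eq_mul ht (single a b hab 1)
  rw [hlie, hab0, hbc1, map_zero, zero_mul, zero_add] at this
  exact this.symm

end CommutingProducts

theorem mainTheorem5 {F V : Type*} [Field F] [CharP F 2]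
    [AddCommGroup V] [Module F V] [FiniteDimensional F V]
    (f : LinearMap.BilinForm F V) (n : ℕ) (hn : 2 < n) :
    ¬ Nonempty (LieAlgebra.SpecialLinear.sl (Fin n) F ≃ₗ⁅F⁆ skewAdjointLieSubalgebra f) := by
  rintro ⟨e⟩
  have hneg : ∀ v : V, -v = v := fun v => by
    rw [← neg_one_smul F v, CharTwo.neg_eq, one_smul]
  have hmem (x : Module.End F V) :
      x ∈ skewAdjointLieSubalgebra f ↔ ∀ v w, f (x v) w = f v (x w) := by
    change x ∈ f.skewAdjointSubmodule ↔ _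
    rw [LinearMap.mem_skewAdjointSubmodule]
    refine forall₂_congr fun v w => ?_
    rw [Pi.neg_apply, hneg]
  refine not_injective_of_mul_closed (X := (skewAdjointLieSubalgebra f).incl.comp e.toLieHom)
    (by simpa using hn) ?_ ?_ (Subtype.val_injective.comp e.injective)
  · exact ⟨e.symm ⟨1, (hmem 1).2 fun v w => rfl⟩, by simp⟩
  · intro x y hxy
    have hc : (e x).1 * (e y).1 = (e y).1 * (e x).1 := by
      have := congrArg Subtype.val (congrArg e hxy)
      rw [LieEquiv.map_lie, map_zero, LieSubalgebra.coe_bracket,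
        LieRing.of_associative_ring_bracket] at this
      exact sub_eq_zero.mp this
    -- Moving both factors across f reverses their order and leaves no sign; commuting restores the
    -- order.
    have hp : (e x).1 * (e y).1 ∈ skewAdjointLieSubalgebra f := by
      rw [hmem]
      intro v w
      rw [Module.End.mul_apply, (hmem _).1 (e x).2, (hmem _).1 (e y).2, hc, Module.End.mul_apply]
    exact ⟨e.symm ⟨_, hp⟩, by simp⟩
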